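/- Let $(Y_i,X_i^*,Z_i)$, $i=1,2,\dots$, be independent and identically distributed observations ($Y_i$ an outcome, $X_i^*$ error-prone proxy measurements, $Z_i$ error-free covariates), and write $(Y,X^*,Z)$ for a generic one. Let $g(x^*,z,\eta)\in\mathbb R^q$ ($\eta\in\mathbb R^q$) be the estimating function for the correction parameters and $\Psi(y,x^*,z;\theta,\eta)\in\mathbb R^p$ ($\theta\in\mathbb R^p$, $\eta\in\mathbb R^q$) the estimating function for the parameters of interest, both measurable in the observation, and put $$g_n(\eta)=\frac1n\sum_{i=1}^n g(X_i^*,Z_i,\eta),\qquad U_n(\theta,\eta)=\frac1n\sum_{i=1}^n\Psi(Y_i,X_i^*,Z_i;\theta,\eta).$$ Let $\xi\in\mathbb R^q$ and $\Theta\in\mathbb R^p$ be the target parameters, i.e. $E\{g(X^*,Z,\xi)\}=0$ and $E\{\Psi(Y,X^*,Z;\Theta,\xi)\}=0$. With the stacked function $\psi(\theta,\eta)=\big(\Psi(Y,X^*,Z;\theta,\eta)^T,\,g(X^*,Z,\eta)^T\big)^T$ set $$A(\Theta,\xi)=E\Big\{\frac{\partial\psi(\theta,\eta)}{\partial(\theta^T,\eta^T)}\Big|_{(\Theta,\xi)}\Big\},\qquad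 B(\Theta,\xi)=E\{\psi(\Theta,\xi)\psi(\Theta,\xi)^T\}.$$ Assume the standard regularity conditions: $E\|\psi(\Theta,\xi)\|^2<\infty$; almost surely $\psi$ is continuously differentiable on a fixed neighbourhood of $(\Theta,\xi)$, and its derivative is bounded there in norm by an integrable function of the observation; and $A(\Theta,\xi)$ is nonsingular. Let $\widehat\xi=\widehat\xi_n$ and $\widehat\Theta=\widehat\Theta_n$ be random vectors, consistent (in probability) for $\xi$ and $\Theta$, which solve $g_n(\widehat\xi)=0$ and $U_n(\widehat\Theta,\widehat\xi)=0$ with probability tending to one as $n\to\infty$ (in particular, this covers exact solutions for every $n$). Then $$A(\Theta,\xi)=\begin{bmatrix}E\{\partial\Psi/\partial\Theta^T\}&E\{\partial\Psi/\partial\xi^T\}\\0&E\{\partial g/\partial\xi^T\}\end{bmatrix}$$ is block upper triangular, $B(\Theta,\xi)$ is symmetric, the matrix $$\Sigma_{(1)}=Q\,A^{-1}(\Theta,\xi)\,B(\Theta,\xi)\,A^{-1}(\Theta,\xi)^T\,Q^T,\qquad Q=[\,I_{p\times p}\ \ 0_{p\times q}\,],$$ is positive semidefinite, and $n^{1/2}(\widehat\Theta-\Theta)$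 converges in distribution to $N(0,\Sigma_{(1)})$ as $n\to\infty$. -/

import Mathlib

open MeasureTheory ProbabilityTheory Filter Topology

namespace StackedMEstimation

noncomputable section

section Estimating

variable {𝓨 𝓧 𝓩 Ω : Type*} {p q : ℕ}

/-- The empirical estimating function
`U_n(θ, η) = n⁻¹ ∑_{i < n} Ψ(Y_i, X*_i, Z_i; θ, η)` for the parameters of interest. -/
def empU (Ψ : 𝓨 → 𝓧 → 𝓩 → EuclideanSpace ℝ (Fin p) → EuclideanSpace ℝ (Fin q) →
      EuclideanSpace ℝ (Fin p))
    (Y : ℕ → Ω → 𝓨) (X : ℕ → Ω → 𝓧) (Z : ℕ → Ω → 𝓩) (n : ℕ) (ω : Ω)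
    (θ : EuclideanSpace ℝ (Fin p)) (η : EuclideanSpace ℝ (Fin q)) : EuclideanSpace ℝ (Fin p) :=
  (n : ℝ)⁻¹ • ∑ i ∈ Finset.range n, Ψ (Y i ω) (X i ω) (Z i ω) θ η

/-- The empirical estimating function `g_n(η) = n⁻¹ ∑_{i < n} g(X*_i, Z_i, η)` for the
correction parameters. -/
def empG (g : 𝓧 → 𝓩 → EuclideanSpace ℝ (Fin q) → EuclideanSpace ℝ (Fin q))
    (X : ℕ → Ω → 𝓧) (Z : ℕ → Ω → 𝓩) (n : ℕ) (ω : Ω)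
    (η : EuclideanSpace ℝ (Fin q)) : EuclideanSpace ℝ (Fin q) :=
  (n : ℝ)⁻¹ • ∑ i ∈ Finset.range n, g (X i ω) (Z i ω) η

/-- The stacked estimating function `(Ψ(o; θ, η), g(o; η))` of one observation
`o = (y, x*, z)`, as a vector with `p + q` coordinates. -/
def stacked (Ψ : 𝓨 → 𝓧 → 𝓩 → EuclideanSpace ℝ (Fin p) → EuclideanSpace ℝ (Fin q) →
      EuclideanSpace ℝ (Fin p))
    (g : 𝓧 → 𝓩 → EuclideanSpace ℝ (Fin q) → EuclideanSpace ℝ (Fin q))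
    (o : 𝓨 × 𝓧 × 𝓩) (t : EuclideanSpace ℝ (Fin p) × EuclideanSpace ℝ (Fin q)) :
    Fin p ⊕ Fin q → ℝ :=
  Sum.elim (fun i => Ψ o.1 o.2.1 o.2.2 t.1 t.2 i) (fun j => g o.2.1 o.2.2 t.2 j)

/-- The coordinate directions of the stacked parameter `(θ, η)`. -/
def coordDir : Fin p ⊕ Fin q → EuclideanSpace ℝ (Fin p) × EuclideanSpace ℝ (Fin q) :=
  Sum.elim (fun i => (EuclideanSpace.single i 1, 0)) (fun j => (0, EuclideanSpace.single j 1))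

/-- The Jacobian matrix `∂f/∂xᵀ` of a map between Euclidean spaces. -/
def jacobian {m n : ℕ} (f : EuclideanSpace ℝ (Fin m) → EuclideanSpace ℝ (Fin n))
    (x : EuclideanSpace ℝ (Fin m)) : Matrix (Fin n) (Fin m) ℝ :=
  Matrix.of fun i j => fderiv ℝ f x (EuclideanSpace.single j 1) i

/-- The entrywise expectation of a random matrix. -/
def expMatrix {O : Type*} [MeasurableSpace O] (ν : Measure O) {α β : Type*}
    (M : O → Matrix α β ℝ) : Matrix α β ℝ :=
  Matrix.of fun a b => ∫ o, M o a b ∂ν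

variable [MeasurableSpace 𝓨] [MeasurableSpace 𝓧] [MeasurableSpace 𝓩]

/-- `A(θ, η)`: the expected Jacobian matrix of the stacked estimating function, with respect to
all `p + q` coordinates of the stacked parameter. -/
def matA (ν : Measure (𝓨 × 𝓧 × 𝓩))
    (Ψ : 𝓨 → 𝓧 → 𝓩 → EuclideanSpace ℝ (Fin p) → EuclideanSpace ℝ (Fin q) →
      EuclideanSpace ℝ (Fin p))
    (g : 𝓧 → 𝓩 → EuclideanSpace ℝ (Fin q) → EuclideanSpace ℝ (Fin q))
    (θ : EuclideanSpace ℝ (Fin p)) (η : EuclideanSpace ℝ (Fin q)) :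
    Matrix (Fin p ⊕ Fin q) (Fin p ⊕ Fin q) ℝ :=
  expMatrix ν fun o => Matrix.of fun a b =>
    fderiv ℝ (fun t => stacked Ψ g o t a) (θ, η) (coordDir b)

/-- `B(θ, η)`: the expected outer product of the stacked estimating function with itself. -/
def matB (ν : Measure (𝓨 × 𝓧 × 𝓩))
    (Ψ : 𝓨 → 𝓧 → 𝓩 → EuclideanSpace ℝ (Fin p) → EuclideanSpace ℝ (Fin q) →
      EuclideanSpace ℝ (Fin p))
    (g : 𝓧 → 𝓩 → EuclideanSpace ℝ (Fin q) → EuclideanSpace ℝ (Fin q))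
    (θ : EuclideanSpace ℝ (Fin p)) (η : EuclideanSpace ℝ (Fin q)) :
    Matrix (Fin p ⊕ Fin q) (Fin p ⊕ Fin q) ℝ :=
  expMatrix ν fun o => Matrix.vecMulVec (stacked Ψ g o (θ, η)) (stacked Ψ g o (θ, η))

/-- `Q = [I_p  0]`. -/
def matQ (p q : ℕ) : Matrix (Fin p) (Fin p ⊕ Fin q) ℝ :=
  Matrix.fromCols 1 0

/-- The asymptotic covariance matrix `Q A⁻¹ B A⁻ᵀ Qᵀ`. -/
def asympCov (ν : Measure (𝓨 × 𝓧 × 𝓩))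
    (Ψ : 𝓨 → 𝓧 → 𝓩 → EuclideanSpace ℝ (Fin p) → EuclideanSpace ℝ (Fin q) →
      EuclideanSpace ℝ (Fin p))
    (g : 𝓧 → 𝓩 → EuclideanSpace ℝ (Fin q) → EuclideanSpace ℝ (Fin q))
    (θ : EuclideanSpace ℝ (Fin p)) (η : EuclideanSpace ℝ (Fin q)) : Matrix (Fin p) (Fin p) ℝ :=
  matQ p q * (matA ν Ψ g θ η)⁻¹ * matB ν Ψ g θ η * ((matA ν Ψ g θ η)⁻¹).transpose
    * (matQ p q).transpose

end Estimating

end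

end StackedMEstimation

open StackedMEstimation

/-! Both estimating equations are treated as one equation for the joint parameter `t = (θ, η)`, so
the effect of estimating `ξ` on `Θhat` is carried by the off-diagonal block of `A`. With `t₀ = (Θ,
ξ)` and `T = (Θhat, ξhat)`, expansion of the stacked equation gives `0 = n^(-1/2) ∑ ψ(W_i, t₀) + (A
+ o_P(1)) √n (T - t₀)`, hence `√n (T - t₀) = -A⁻¹ n^(-1/2) ∑ ψ(W_i, t₀) + o_P(1)`
(`tendstoInMeasure_linearization`). The `θ`-component of the leading term is a normalized sum of iid
centered vectors with covariance `Q A⁻¹ B A⁻ᵀ Qᵀ`; the central limit theorem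
(`tendstoInDistribution_scaled_sum`) and Slutsky's theorem conclude.

The delicate point is the Taylor remainder, as no second derivative is available. Its supremum over
a `δ`-ball, divided by `‖t - t₀‖`, tends to `0` pointwise as `δ → 0` and is dominated by `2 H`, so
its expectation is small for small `δ` (`exists_integrable_remainder_bound`). Markov's inequality
then controls the empirical remainder.

The zero block of `A` reflects that `g` does not involve `θ`; semidefiniteness is inherited from the
expected outer product `B` by congruence. -/

namespace StackedMEstimation

/-! ### Measurability of derivatives and control of the Taylor remainder -/

section Remainder

variable {O E F : Type*} [MeasurableSpace O] {ν : Measure O}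
  [NormedAddCommGroup E] [NormedSpace ℝ E] [FiniteDimensional ℝ E]
  [NormedAddCommGroup F] [NormedSpace ℝ F]

/-- The derivative of a random function at a fixed point is a.e. strongly measurable. -/
lemma aestronglyMeasurable_fderiv_param {ψ : O → E → F} {t₀ : E}
    (hm : ∀ t, AEStronglyMeasurable (fun o => ψ o t) ν)
    (hd : ∀ᵐ o ∂ν, DifferentiableAt ℝ (ψ o) t₀) :
    AEStronglyMeasurable (fun o => fderiv ℝ (ψ o) t₀) ν := by
  have happly (v : E) : AEStronglyMeasurable (fun o => fderiv ℝ (ψ o) t₀ v) ν := by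
    -- A directional derivative is the limit of the difference quotients with step `1 / n`, which
    -- are measurable in `o`.
    refine aestronglyMeasurable_of_tendsto_ae (atTop : Filter ℕ)
      (f := fun n o => (n : ℝ) • (ψ o (t₀ + (n : ℝ)⁻¹ • v) - ψ o t₀)) (fun n => ?_) ?_
    · exact ((hm _).sub (hm _)).const_smul _
    · filter_upwards [hd] with o ho
      exact (ho.hasFDerivAt.lim_real v).comp tendsto_natCast_atTop_atTop
  let b := Module.finBasis ℝ E
  let c := fun i => LinearMap.toContinuousLinearMap (b.coord i)
  -- The derivative is recovered from its values on a finite basis, so measurability lifts from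
  -- vectors to operators.
  have hsum (o : O) : fderiv ℝ (ψ o) t₀
      = ∑ i, ContinuousLinearMap.smulRightL ℝ E F (c i) (fderiv ℝ (ψ o) t₀ (b i)) := by
    ext v
    conv_lhs => rw [← b.sum_repr v, map_sum]
    simp [c]
  rw [funext hsum]
  exact Finset.aestronglyMeasurable_fun_sum _ fun i _ =>
    (ContinuousLinearMap.continuous _).comp_aestronglyMeasurable (happly _)

/-- The first-order Taylor remainder of a random function with dominated derivative is controlled,
uniformly on a small ball, by a random Lipschitz constant with small expectation. -/
lemma exists_integrable_remainder_bound {ψ : O → E → F} {t₀ : E} {r : ℝ} (hr : 0 < r)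
    (hm : ∀ t, AEStronglyMeasurable (fun o => ψ o t) ν)
    (hd : ∀ᵐ o ∂ν, DifferentiableOn ℝ (ψ o) (Metric.ball t₀ r))
    {H : O → ℝ} (hH : Integrable H ν)
    (hbound : ∀ᵐ o ∂ν, ∀ t ∈ Metric.ball t₀ r, ‖fderiv ℝ (ψ o) t‖ ≤ H o)
    {ε : ℝ} (hε : 0 < ε) :
    ∃ δ > 0, ∃ m : O → ℝ, 0 ≤ m ∧ Integrable m ν ∧ ∫ o, m o ∂ν ≤ ε ∧
      ∀ᵐ o ∂ν, ∀ t ∈ Metric.ball t₀ δ,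
        ‖ψ o t - ψ o t₀ - fderiv ℝ (ψ o) t₀ (t - t₀)‖ ≤ m o * ‖t - t₀‖ := by
  have ht₀ : t₀ ∈ Metric.ball t₀ r := Metric.mem_ball_self hr
  have hdat : ∀ᵐ o ∂ν, ∀ t ∈ Metric.ball t₀ r, DifferentiableAt ℝ (ψ o) t := by
    filter_upwards [hd] with o ho t ht using ho.differentiableAt (Metric.isOpen_ball.mem_nhds ht)
  have hDm : AEStronglyMeasurable (fun o => fderiv ℝ (ψ o) t₀) ν :=
    aestronglyMeasurable_fderiv_param hm (hdat.mono fun o ho => ho t₀ ht₀)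
  set R : O → E → F := fun o t => ψ o t - ψ o t₀ - fderiv ℝ (ψ o) t₀ (t - t₀) with hR
  have hRm (t : E) : AEStronglyMeasurable (fun o => R o t) ν :=
    ((hm t).sub (hm t₀)).sub
      ((ContinuousLinearMap.apply ℝ F (t - t₀)).continuous.comp_aestronglyMeasurable hDm)
  -- The supremum defining `m` runs over a countable dense set to remain measurable; continuity of
  -- the remainder later extends the bound to the whole ball.
  let u : ℕ → E := TopologicalSpace.denseSeq E
  let δ : ℕ → ℝ := fun k => r / (k + 1)
  have hδpos (k : ℕ) : 0 < δ k := by positivity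
  have hδr (k : ℕ) : δ k ≤ r := div_le_self hr.le (by simp)
  have hδlim : Tendsto δ atTop (𝓝 0) := by
    have := tendsto_one_div_add_atTop_nhds_zero_nat (𝕜 := ℝ) |>.const_mul r
    simpa [δ, div_eq_mul_inv] using this
  let m : ℕ → O → ENNReal := fun k o =>
    ⨆ j, Set.indicator {j | u j ∈ Metric.ball t₀ (δ k)}
      (fun j => ENNReal.ofReal (‖R o (u j)‖ / ‖u j - t₀‖)) j
  have hmm (k : ℕ) : AEMeasurable (m k) ν := by
    refine AEMeasurable.iSup fun j => ?_
    by_cases hj : u j ∈ Metric.ball t₀ (δ k)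
    · simp only [Set.indicator, Set.mem_ofPred_eq, hj, if_true]
      exact ((hRm _).norm.aemeasurable.div_const _).ennreal_ofReal
    · simp only [Set.indicator, Set.mem_ofPred_eq, hj, if_false]
      exact aemeasurable_const
  have hle {k : ℕ} {o : O} {c : ℝ}
      (h : ∀ t ∈ Metric.ball t₀ (δ k), ‖R o t‖ ≤ c * ‖t - t₀‖) (hc : 0 ≤ c) :
      m k o ≤ ENNReal.ofReal c := by
    refine iSup_le fun j => ?_
    refine Set.indicator_apply_le' (fun hj => ?_) (fun _ => zero_le)
    exact ENNReal.ofReal_le_ofReal (div_le_of_le_mul₀ (norm_nonneg _) hc (h _ hj))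
  have hdom : ∀ᵐ o ∂ν, ∀ k, m k o ≤ ENNReal.ofReal (2 * H o) := by
    filter_upwards [hdat, hbound] with o ho hb k
    have hHo : 0 ≤ H o := (norm_nonneg _).trans (hb t₀ ht₀)
    -- Mean value inequality for `ψ o - fderiv ℝ (ψ o) t₀`, whose derivative has norm at most `2 H
    -- o` on the ball.
    refine hle (fun t ht => ?_) (by positivity)
    refine Convex.norm_image_sub_le_of_norm_fderiv_le' (𝕜 := ℝ) (s := Metric.ball t₀ r)
      ho (fun x hx => ?_) (convex_ball _ _) ht₀ (Metric.ball_subset_ball (hδr k) ht)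
    calc ‖fderiv ℝ (ψ o) x - fderiv ℝ (ψ o) t₀‖ ≤ H o + H o :=
          (norm_sub_le _ _).trans (add_le_add (hb x hx) (hb t₀ ht₀))
      _ = 2 * H o := by ring
  have hlim : ∀ᵐ o ∂ν, Tendsto (fun k => m k o) atTop (𝓝 0) := by
    filter_upwards [hdat] with o ho
    rw [ENNReal.tendsto_nhds_zero]
    intro e he
    obtain ⟨c, hc0, hce⟩ : ∃ c : ℝ, 0 < c ∧ ENNReal.ofReal c ≤ e := by
      obtain ⟨x, hx0, hxe⟩ := ENNReal.lt_iff_exists_nnreal_btwn.1 he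
      exact ⟨x, by exact_mod_cast hx0, by simpa using hxe.le⟩
    have h1 := (ho t₀ ht₀).hasFDerivAt.isLittleO.def hc0
    obtain ⟨d, hd0, hdsub⟩ := Metric.eventually_nhds_iff_ball.1 h1
    filter_upwards [hδlim.eventually_lt_const hd0] with k hk
    exact (hle (fun t ht => hdsub t (Metric.ball_subset_ball hk.le ht)) hc0.le).trans hce
  have hint : Tendsto (fun k => ∫⁻ o, m k o ∂ν) atTop (𝓝 0) := by
    have := tendsto_lintegral_of_dominated_convergence' (fun o => ENNReal.ofReal (2 * H o)) hmm
      (fun k => hdom.mono fun o ho => ho k) ((hH.const_mul 2).lintegral_lt_top.ne) hlim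
    simpa using this
  obtain ⟨k, hk⟩ := (hint.eventually_le_const (ENNReal.ofReal_pos.2 hε)).exists
  have hkfin : ∫⁻ o, m k o ∂ν ≠ ⊤ := (hk.trans_lt ENNReal.ofReal_lt_top).ne
  refine ⟨δ k, hδpos k, fun o => (m k o).toReal, fun o => ENNReal.toReal_nonneg,
    integrable_toReal_of_lintegral_ne_top (hmm k) hkfin, ?_, ?_⟩
  · rw [integral_toReal (hmm k) (ae_lt_top' (hmm k) hkfin)]
    exact ENNReal.toReal_le_of_le_ofReal hε.le hk
  · filter_upwards [hdat, hdom] with o ho hdo t ht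
    have hcont (s : Set E) : ContinuousWithinAt (R o) s t := by
      have := (ho t (Metric.ball_subset_ball (hδr k) ht)).continuousAt
      have h2 : Continuous fun t => fderiv ℝ (ψ o) t₀ (t - t₀) := by fun_prop
      exact ((this.sub continuousAt_const).sub h2.continuousAt).continuousWithinAt
    refine ContinuousWithinAt.closure_le
      ((TopologicalSpace.denseRange_denseSeq E).open_subset_closure_inter Metric.isOpen_ball ht)
      (hcont _).norm
      (continuous_const.mul (continuous_id.sub continuous_const).norm).continuousWithinAt ?_
    rintro _ ⟨hj, j, rfl⟩
    have h1 : ENNReal.ofReal (‖R o (u j)‖ / ‖u j - t₀‖) ≤ m k o := by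
      refine le_trans (le_of_eq ?_) (le_iSup _ j)
      exact (Set.indicator_of_mem (s := {j | u j ∈ Metric.ball t₀ (δ k)}) hj
        fun j => ENNReal.ofReal (‖R o (u j)‖ / ‖u j - t₀‖)).symm
    have h2 := (ENNReal.ofReal_le_iff_le_toReal (ne_top_of_le_ne_top ENNReal.ofReal_ne_top (hdo k))).1 h1
    -- At `u j = t₀` the quotient is the default `0 / 0 = 0` and says nothing, but there both sides
    -- vanish.
    rcases eq_or_ne (u j) t₀ with h | h
    · change ‖R o (u j)‖ ≤ _ * ‖u j - t₀‖
      simp [h, hR]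
    · exact (div_le_iff₀ (norm_pos_iff.2 (sub_ne_zero.2 h))).1 h2

end Remainder

/-! ### Law of large numbers, tightness and central limit theorem for iid sums -/

section Sums

variable {Ω O : Type*} [MeasurableSpace Ω] [MeasurableSpace O] {P : Measure Ω}
  {ν : Measure O} {W : ℕ → Ω → O}

lemma ae_comp_of_hasLaw {W : Ω → O} (hW : HasLaw W ν P) {p : O → Prop} (h : ∀ᵐ o ∂ν, p o) :
    ∀ᵐ ω ∂P, p (W ω) :=
  ae_of_ae_map hW.aemeasurable (hW.map_eq.symm ▸ h)

lemma integrable_comp_of_hasLaw {F : Type*} [NormedAddCommGroup F] {W : Ω → O}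
    (hW : HasLaw W ν P) {f : O → F} (h : Integrable f ν) : Integrable (fun ω => f (W ω)) P :=
  Integrable.comp_aemeasurable (f := W) (by rwa [hW.map_eq]) hW.aemeasurable

lemma memLp_comp_of_hasLaw {F : Type*} [NormedAddCommGroup F] {W : Ω → O}
    (hW : HasLaw W ν P) {f : O → F} {p : ENNReal} (h : MemLp f p ν) :
    MemLp (fun ω => f (W ω)) p P := by
  rw [← hW.map_eq] at h
  exact h.comp_of_map hW.aemeasurable

lemma identDistrib_comp_of_hasLaw {F : Type*} [MeasurableSpace F]
    (hW : ∀ i, HasLaw (W i) ν P) {f : O → F} (hf : Measurable f) (i j : ℕ) :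
    IdentDistrib (fun ω => f (W i ω)) (fun ω => f (W j ω)) P P :=
  ((hW i).identDistrib (hW j)).comp hf

lemma aemeasurable_scaled_sum {ι : Type*} [Fintype ι] (hW : ∀ i, HasLaw (W i) ν P)
    {f : O → EuclideanSpace ℝ ι} (hfm : Measurable f) (n : ℕ) :
    AEMeasurable (fun ω => (√(n : ℝ))⁻¹ • ∑ i ∈ Finset.range n, f (W i ω)) P := by
  have := fun i => (hW i).aemeasurable
  fun_prop

/-- Strong law of large numbers for an integrable function of independent observations. -/
lemma ae_tendsto_mean {F : Type*} [NormedAddCommGroup F] [NormedSpace ℝ F] [CompleteSpace F]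
    (hW : ∀ i, HasLaw (W i) ν P) (hindep : iIndepFun W P) {f : O → F} (hf : Integrable f ν) :
    ∀ᵐ ω ∂P, Tendsto (fun n : ℕ => (n : ℝ)⁻¹ • ∑ i ∈ Finset.range n, f (W i ω)) atTop
      (𝓝 (∫ o, f o ∂ν)) := by
  borelize F
  -- Independence passes to compositions with measurable maps, hence the measurable representative.
  let f' := hf.aestronglyMeasurable.mk f
  have hf'm : Measurable f' := hf.aestronglyMeasurable.stronglyMeasurable_mk.measurable
  have hff' : f =ᵐ[ν] f' := hf.aestronglyMeasurable.ae_eq_mk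
  have hf' : Integrable f' ν := hf.congr hff'
  have hslln := strong_law_ae (fun i ω => f' (W i ω)) (integrable_comp_of_hasLaw (hW 0) hf')
    (fun i j hij => (hindep.indepFun hij).comp hf'm hf'm)
    (fun i => identDistrib_comp_of_hasLaw hW hf'm i 0)
  have hint : ∫ ω, f' (W 0 ω) ∂P = ∫ o, f o ∂ν :=
    ((hW 0).integral_comp hf'.aestronglyMeasurable).trans (integral_congr_ae hff'.symm)
  filter_upwards [hslln, ae_all_iff.2 fun i => ae_comp_of_hasLaw (hW i) hff'] with ω hω he
  simpa [he, ← hint] using hω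

variable [IsProbabilityMeasure P]

/-- Normalized sums of centered square integrable functions of independent observations are
bounded in probability. -/
lemma exists_measureReal_le_norm_scaled_sum_le_real (hW : ∀ i, HasLaw (W i) ν P)
    (hindep : iIndepFun W P) {f : O → ℝ} (hfm : Measurable f) (hf : MemLp f 2 ν)
    (hf0 : ∫ o, f o ∂ν = 0) {ε : ℝ} (hε : 0 < ε) :
    ∃ M : ℝ, 0 < M ∧ ∀ n : ℕ,
      P.real {ω | M ≤ |(√(n : ℝ))⁻¹ * ∑ i ∈ Finset.range n, f (W i ω)|} ≤ ε := by
  set v := Var[fun ω => f (W 0 ω); P] with hv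
  have hv0 : 0 ≤ v := variance_nonneg _ _
  -- Chebyshev bounds the probability by `v / M² = v ε / (v + 1) ≤ ε`; the `+ 1` keeps `M` positive
  -- when `v = 0`.
  refine ⟨√((v + 1) / ε), by positivity, fun n => ?_⟩
  have hmem (i : ℕ) : MemLp (fun ω => f (W i ω)) 2 P := memLp_comp_of_hasLaw (hW i) hf
  have hmean (i : ℕ) : ∫ ω, f (W i ω) ∂P = 0 :=
    ((hW i).integral_comp hf.aestronglyMeasurable).trans hf0
  set S : Ω → ℝ := ∑ i ∈ Finset.range n, fun ω => f (W i ω) with hS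
  have hSmem : MemLp S 2 P := memLp_finsetSum' _ fun i _ => hmem i
  have hS0 : ∫ ω, S ω ∂P = 0 := by
    simp only [hS, Finset.sum_apply]
    rw [integral_finsetSum _ fun i _ => (hmem i).integrable (by norm_num)]
    simp [hmean]
  have hSv : Var[S; P] = n * v := by
    rw [hS, IndepFun.variance_sum (fun i _ => hmem i)
      (fun i _ j _ hij => (hindep.indepFun hij).comp hfm hfm)]
    simp [(identDistrib_comp_of_hasLaw hW hfm _ 0).variance_eq, hv]
  have hVar : Var[fun ω => (√(n : ℝ))⁻¹ * S ω; P] ≤ v := by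
    rw [variance_const_mul, hSv, inv_pow, Real.sq_sqrt (Nat.cast_nonneg n)]
    rcases eq_or_ne (n : ℝ) 0 with h | h
    · simp [h, hv0]
    · rw [inv_mul_cancel_left₀ h]
  have hcheb := meas_ge_le_variance_div_sq (hSmem.const_mul (√(n : ℝ))⁻¹)
    (c := √((v + 1) / ε)) (by positivity)
  have hmean0 : ∫ ω, (√(n : ℝ))⁻¹ * S ω ∂P = 0 := by rw [integral_const_mul, hS0, mul_zero]
  rw [hmean0, Real.sq_sqrt (by positivity)] at hcheb
  simp only [sub_zero, hS, Finset.sum_apply] at hcheb hVar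
  refine ENNReal.toReal_le_of_le_ofReal hε.le (hcheb.trans (ENNReal.ofReal_le_ofReal ?_))
  rw [div_le_iff₀ (by positivity), mul_div_cancel₀ _ hε.ne']
  linarith

/-- Union bound over the finitely many coordinates: a large sup norm forces some coordinate to be
large. The `+ 1` in `card ι + 1` and in `1 + ∑ a, M a` covers empty `ι`. -/
lemma exists_measureReal_le_norm_scaled_sum_le {ι : Type*} [Fintype ι]
    (hW : ∀ i, HasLaw (W i) ν P) (hindep : iIndepFun W P) {f : O → ι → ℝ} (hfm : Measurable f)
    (hf : MemLp f 2 ν) (hf0 : ∫ o, f o ∂ν = 0) {ε : ℝ} (hε : 0 < ε) :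
    ∃ M : ℝ, 0 < M ∧ ∀ n : ℕ,
      P.real {ω | M ≤ ‖(√(n : ℝ))⁻¹ • ∑ i ∈ Finset.range n, f (W i ω)‖} ≤ ε := by
  have : IsProbabilityMeasure ν := (hW 0).isProbabilityMeasure_iff.1 ‹_›
  have hfa (a : ι) : ∫ o, f o a ∂ν = 0 := by
    have := (ContinuousLinearMap.proj (R := ℝ) (φ := fun _ : ι => ℝ) a).integral_comp_comm
      (hf.integrable (by norm_num))
    simpa [hf0] using this
  have key (a : ι) := exists_measureReal_le_norm_scaled_sum_le_real hW hindep
    ((measurable_pi_apply a).comp hfm) (hf.eval a) (hfa a)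
    (show 0 < ε / (Fintype.card ι + 1) by positivity)
  choose M hM0 hM using key
  refine ⟨1 + ∑ a, M a, by have := Finset.sum_nonneg fun a (_ : a ∈ Finset.univ) => (hM0 a).le
                           linarith, fun n => ?_⟩
  have hsub : {ω | 1 + ∑ a, M a ≤ ‖(√(n : ℝ))⁻¹ • ∑ i ∈ Finset.range n, f (W i ω)‖}
      ⊆ ⋃ a, {ω | M a ≤ |(√(n : ℝ))⁻¹ * ∑ i ∈ Finset.range n, f (W i ω) a|} := by
    intro ω hω
    by_contra hcon
    simp only [Set.mem_iUnion, Set.mem_ofPred_eq, not_exists, not_le] at hcon hω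
    have hnn : 0 ≤ ∑ a, M a := Finset.sum_nonneg fun a _ => (hM0 a).le
    have : ‖(√(n : ℝ))⁻¹ • ∑ i ∈ Finset.range n, f (W i ω)‖ ≤ ∑ a, M a := by
      refine (pi_norm_le_iff_of_nonneg hnn).2 fun a => ?_
      have h1 := (hcon a).le.trans
        (Finset.single_le_sum (fun b _ => (hM0 b).le) (Finset.mem_univ a))
      simpa [Finset.sum_apply] using h1
    linarith
  calc _ ≤ P.real (⋃ a, {ω | M a ≤ |(√(n : ℝ))⁻¹ * ∑ i ∈ Finset.range n, f (W i ω) a|}) :=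
        measureReal_mono hsub
    _ ≤ ∑ a : ι, ε / (Fintype.card ι + 1) :=
        (measureReal_iUnion_fintype_le _).trans (Finset.sum_le_sum fun a _ => hM a n)
    _ ≤ ε := by
      rw [Finset.sum_const, Finset.card_univ, nsmul_eq_mul, ← mul_div_assoc,
        div_le_iff₀ (by positivity)]
      nlinarith

/-- **Multivariate central limit theorem** for a centered square integrable function of
independent, identically distributed observations. -/
theorem tendstoInDistribution_scaled_sum {ι : Type*} [Fintype ι] [DecidableEq ι]
    (hW : ∀ i, HasLaw (W i) ν P) (hindep : iIndepFun W P) {f : O → EuclideanSpace ℝ ι}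
    (hfm : Measurable f) (hf : MemLp f 2 ν) (hf0 : ∫ o, f o ∂ν = 0)
    {S : Matrix ι ι ℝ} (hS : S.PosSemidef)
    (hcov : ∀ x : EuclideanSpace ℝ ι, x.ofLp ⬝ᵥ S.mulVec x.ofLp = ∫ o, inner ℝ (f o) x ^ 2 ∂ν) :
    TendstoInDistribution (fun (n : ℕ) ω => (√(n : ℝ))⁻¹ • ∑ i ∈ Finset.range n, f (W i ω)) atTop
      (id : EuclideanSpace ℝ ι → EuclideanSpace ℝ ι) (fun _ => P) (multivariateGaussian 0 S) where
  forall_aemeasurable n := aemeasurable_scaled_sum hW hfm n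
  tendsto := by
    have : IsProbabilityMeasure ν := (hW 0).isProbabilityMeasure_iff.1 ‹_›
    -- Cramér–Wold: the characteristic function at `t` is that of the projection on `t` evaluated at
    -- `1`, so the scalar central limit theorem suffices.
    refine ProbabilityMeasure.tendsto_iff_tendsto_charFun.2 fun t => ?_
    have hgm : Measurable fun o => inner ℝ (f o) t := by fun_prop
    have hg2 : MemLp (fun o => inner ℝ (f o) t) 2 ν := hf.inner_const t
    have hg0 : ∫ o, inner ℝ (f o) t ∂ν = 0 := by
      have := integral_inner (𝕜 := ℝ) (hf.integrable (by norm_num)) t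
      simp_rw [real_inner_comm t]
      simpa [hf0] using this
    have hmean : ∫ ω, inner ℝ (f (W 0 ω)) t ∂P = 0 :=
      ((hW 0).integral_comp hg2.aestronglyMeasurable).trans hg0
    have hvar : Var[fun ω => inner ℝ (f (W 0 ω)) t; P] = t.ofLp ⬝ᵥ S.mulVec t.ofLp := by
      rw [variance_of_integral_eq_zero
        (X := fun ω => inner ℝ (f (W 0 ω)) t) (hgm.comp_aemeasurable (hW 0).aemeasurable) hmean, hcov]
      exact (hW 0).integral_comp (hg2.aestronglyMeasurable.pow 2)
    have hclt := tendstoInDistribution_inv_sqrt_mul_sum_sub (P := P)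
      (X := fun i ω => inner ℝ (f (W i ω)) t) HasLaw.id
      (memLp_comp_of_hasLaw (hW 0) hg2) (hindep.comp (fun _ o => inner ℝ (f o) t) fun _ => hgm)
      (fun i => identDistrib_comp_of_hasLaw hW hgm i 0)
    have h1 := ProbabilityMeasure.tendsto_iff_tendsto_charFun.1 hclt.tendsto 1
    have hnn : 0 ≤ t.ofLp ⬝ᵥ S.mulVec t.ofLp := hvar ▸ variance_nonneg _ _
    simp only [ProbabilityMeasure.coe_mk, Measure.map_id, hvar, charFun_gaussianReal, hmean] at h1
    simp only [ProbabilityMeasure.coe_mk, Measure.map_id, charFun_multivariateGaussian hS]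
    convert! h1 using 2 with n
    · rw [charFun_apply, charFun_apply, integral_map, integral_map]
      · simp [sum_inner, inner_smul_left]
      · exact hmean ▸ hclt.forall_aemeasurable n
      · exact Continuous.aestronglyMeasurable (by fun_prop)
      · exact aemeasurable_scaled_sum hW hfm n
      · exact Continuous.aestronglyMeasurable (by fun_prop)
    · simp [Real.coe_toNNReal _ hnn]

end Sums

/-! ### Asymptotic linearity of the estimator -/

section Linearization

/-- If `A` has the left inverse `L` and `x` solves an equation whose linear part is close to
`s + A x`, then `x` is close to `-L s`. -/
lemma norm_add_le_of_approx_linear {E F : Type*} [NormedAddCommGroup E] [NormedSpace ℝ E]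
    [NormedAddCommGroup F] [NormedSpace ℝ F] {L : F →L[ℝ] E} {A D : E →L[ℝ] F}
    (hL : L ∘L A = ContinuousLinearMap.id ℝ E) {x : E} {s : F} {m κ : ℝ}
    (hrem : ‖s + D x‖ ≤ m * ‖x‖) (hκ : ‖L‖ * (‖D - A‖ + m) ≤ κ) (hκ2 : κ ≤ 1 / 2) :
    ‖x + L s‖ ≤ 2 * κ * ‖L s‖ := by
  have hx : x + L s = L (s + D x) - L ((D - A) x) := by
    have : L (A x) = x := congrArg (· x) hL
    simp only [map_add, sub_apply, map_sub, this]
    abel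
  have h1 : ‖x + L s‖ ≤ κ * ‖x‖ := by
    rw [hx]
    calc _ ≤ ‖L (s + D x)‖ + ‖L ((D - A) x)‖ := norm_sub_le _ _
      _ ≤ ‖L‖ * (m * ‖x‖) + ‖L‖ * (‖D - A‖ * ‖x‖) := by
          gcongr
          · exact (L.le_opNorm _).trans (by gcongr)
          · exact (L.le_opNorm _).trans (by gcongr; exact (D - A).le_opNorm x)
      _ = ‖L‖ * (‖D - A‖ + m) * ‖x‖ := by ring
      _ ≤ κ * ‖x‖ := by gcongr
  -- For `x ≠ 0`, `h1` forces `0 ≤ κ`, and `κ ≤ 1 / 2` lets `κ ‖x‖` be absorbed, giving `‖x‖ ≤ 2 ‖L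
  -- s‖`.
  rcases eq_or_ne x 0 with rfl | hx0
  · have : ‖(0 : E) + L s‖ ≤ 0 := by simpa using h1
    have hLs : ‖L s‖ = 0 := le_antisymm (by simpa using this) (norm_nonneg _)
    simp [hLs]
  · have hxpos : 0 < ‖x‖ := norm_pos_iff.2 hx0
    have hκ0 : 0 ≤ κ := by
      by_contra! hneg
      have := (norm_nonneg _).trans h1
      nlinarith
    have h2 : ‖x‖ ≤ ‖x + L s‖ + ‖L s‖ := by
      simpa using norm_sub_le (x + L s) (L s)
    have h3 : ‖x‖ ≤ 2 * ‖L s‖ := by nlinarith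
    nlinarith

variable {Ω O E ι : Type*} [MeasurableSpace Ω] [MeasurableSpace O] [Fintype ι] {P : Measure Ω}
  {ν : Measure O} {W : ℕ → Ω → O}
  [NormedAddCommGroup E] [NormedSpace ℝ E] [FiniteDimensional ℝ E]

/-- Markov's inequality for the mean of a nonnegative function of the observations. -/
lemma measureReal_le_mean_le (hW : ∀ i, HasLaw (W i) ν P) {m : O → ℝ} (hm0 : 0 ≤ m)
    (hm : Integrable m ν) {c : ℝ} (hc : 0 < c) (n : ℕ) :
    P.real {ω | c ≤ (n : ℝ)⁻¹ * ∑ i ∈ Finset.range n, m (W i ω)} ≤ (∫ o, m o ∂ν) / c := by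
  have hi (i : ℕ) : Integrable (fun ω => m (W i ω)) P := integrable_comp_of_hasLaw (hW i) hm
  have hint (i : ℕ) : ∫ ω, m (W i ω) ∂P = ∫ o, m o ∂ν :=
    (hW i).integral_comp hm.aestronglyMeasurable
  have hnn : 0 ≤ ∫ o, m o ∂ν := integral_nonneg hm0
  rw [le_div_iff₀' hc]
  refine (mul_meas_ge_le_integral_of_nonneg (ae_of_all _ fun ω => ?_)
    ((integrable_finsetSum _ fun i _ => hi i).const_mul _) c).trans ?_
  · exact mul_nonneg (by positivity) (Finset.sum_nonneg fun i _ => hm0 _)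
  · rw [integral_const_mul, integral_finsetSum _ fun i _ => hi i]
    simp only [hint, Finset.sum_const, Finset.card_range, nsmul_eq_mul]
    rcases eq_or_ne (n : ℝ) 0 with h | h
    · simp [h, hnn]
    · rw [inv_mul_cancel_left₀ h]

variable [IsProbabilityMeasure P]

/-- **Asymptotic linearity** of a consistent solution of an estimating equation. -/
theorem tendstoInMeasure_linearization (hW : ∀ i, HasLaw (W i) ν P) (hindep : iIndepFun W P)
    {ψ : O → E → ι → ℝ} {t₀ : E} {r : ℝ} (hr : 0 < r)
    (hm : ∀ t, Measurable (fun o => ψ o t))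
    (hψ2 : MemLp (fun o => ψ o t₀) 2 ν) (hψ0 : ∫ o, ψ o t₀ ∂ν = 0)
    (hd : ∀ᵐ o ∂ν, DifferentiableOn ℝ (ψ o) (Metric.ball t₀ r))
    {H : O → ℝ} (hH : Integrable H ν)
    (hbound : ∀ᵐ o ∂ν, ∀ t ∈ Metric.ball t₀ r, ‖fderiv ℝ (ψ o) t‖ ≤ H o)
    {L : (ι → ℝ) →L[ℝ] E}
    (hL : L ∘L (∫ o, fderiv ℝ (ψ o) t₀ ∂ν) = ContinuousLinearMap.id ℝ E)
    {T : ℕ → Ω → E}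
    (hTeq : Tendsto (fun n : ℕ => P.real
      {ω | (n : ℝ)⁻¹ • ∑ i ∈ Finset.range n, ψ (W i ω) (T n ω) ≠ 0}) atTop (𝓝 0))
    (hTc : TendstoInMeasure P T atTop (fun _ => t₀)) :
    TendstoInMeasure P (fun (n : ℕ) ω => √(n : ℝ) • (T n ω - t₀)
      + L ((√(n : ℝ))⁻¹ • ∑ i ∈ Finset.range n, ψ (W i ω) t₀)) atTop (fun _ => 0) := by
  rw [tendstoInMeasure_iff_measureReal_norm] at hTc ⊢
  have ht₀ : t₀ ∈ Metric.ball t₀ r := Metric.mem_ball_self hr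
  have hDm : AEStronglyMeasurable (fun o => fderiv ℝ (ψ o) t₀) ν :=
    aestronglyMeasurable_fderiv_param (fun t => (hm t).aestronglyMeasurable)
      (hd.mono fun o ho => ho.differentiableAt (Metric.isOpen_ball.mem_nhds ht₀))
  have hDi : Integrable (fun o => fderiv ℝ (ψ o) t₀) ν :=
    hH.mono' hDm (hbound.mono fun o ho => ho t₀ ht₀)
  set A := ∫ o, fderiv ℝ (ψ o) t₀ ∂ν with hA
  let D : ℕ → Ω → E →L[ℝ] (ι → ℝ) := fun n ω =>
    (n : ℝ)⁻¹ • ∑ i ∈ Finset.range n, fderiv ℝ (ψ (W i ω)) t₀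
  have hDlim : ∀ c > 0, Tendsto (fun n => P.real {ω | c ≤ ‖D n ω - A‖}) atTop (𝓝 0) := by
    refine tendstoInMeasure_iff_measureReal_norm.1 (tendstoInMeasure_of_tendsto_ae (fun n => ?_)
      (ae_tendsto_mean hW hindep hDi))
    exact AEStronglyMeasurable.const_smul (Finset.aestronglyMeasurable_fun_sum _ fun i _ =>
      (integrable_comp_of_hasLaw (hW i) hDi).aestronglyMeasurable) (n : ℝ)⁻¹
  intro ε hε
  simp only [sub_zero]
  refine tendsto_order.2 ⟨fun a ha => .of_forall fun n => ha.trans_le measureReal_nonneg,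
    fun η hη => ?_⟩
  -- Five exceptional events get probability at most `η / 8` each and a sixth is null, for a total
  -- below `η`.
  obtain ⟨M, hM0, hM⟩ := exists_measureReal_le_norm_scaled_sum_le hW hindep (hm t₀) hψ2 hψ0
    (show 0 < η / 8 by positivity)
  -- The bound `1 / 2` permits the absorption; the other entry makes the final error `2 κ ‖L‖ M`
  -- less than `ε`. Adding `1` to `‖L‖` covers `L = 0`.
  set κ : ℝ := min (1 / 2) (ε / (4 * (‖L‖ + 1) * M))
  have hκ0 : 0 < κ := lt_min (by norm_num) (by positivity)
  have hκε : 2 * κ * (‖L‖ * M) < ε := by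
    have h1 : κ * (4 * (‖L‖ + 1) * M) ≤ ε := (le_div_iff₀ (by positivity)).1 (min_le_right _ _)
    nlinarith [mul_pos hκ0 hM0]
  set c : ℝ := κ / (2 * (‖L‖ + 1))
  have hc0 : 0 < c := by positivity
  have hcκ : ‖L‖ * (c + c) ≤ κ := by
    have h1 : c * (2 * (‖L‖ + 1)) = κ := div_mul_cancel₀ _ (by positivity)
    nlinarith
  -- With mean at most `c * (η / 8)`, Markov's inequality puts the empirical mean of `m` above `c`
  -- with probability at most `η / 8`.
  obtain ⟨δ, hδ0, m, hm0, hmi, hmle, hrem⟩ := exists_integrable_remainder_bound hr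
    (fun t => (hm t).aestronglyMeasurable) hd hH hbound (show 0 < c * (η / 8) by positivity)
  have hremW : ∀ᵐ ω ∂P, ∀ i, ∀ t ∈ Metric.ball t₀ δ,
      ‖ψ (W i ω) t - ψ (W i ω) t₀ - fderiv ℝ (ψ (W i ω)) t₀ (t - t₀)‖
        ≤ m (W i ω) * ‖t - t₀‖ := ae_all_iff.2 fun i => ae_comp_of_hasLaw (hW i) hrem
  filter_upwards [(hDlim c hc0).eventually_lt_const (show 0 < η / 8 by positivity),
    (hTc δ hδ0).eventually_lt_const (show 0 < η / 8 by positivity),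
    hTeq.eventually_lt_const (show 0 < η / 8 by positivity), eventually_ge_atTop 1]
    with n hnD hnT hneq hn1
  have hn0 : (0 : ℝ) < n := by exact_mod_cast hn1
  have hmark : P.real {ω | c ≤ (n : ℝ)⁻¹ * ∑ i ∈ Finset.range n, m (W i ω)} ≤ η / 8 :=
    (measureReal_le_mean_le hW hm0 hmi hc0 n).trans ((div_le_iff₀' hc0).2 hmle)
  set badD := {ω | c ≤ ‖D n ω - A‖}
  set badT := {ω | δ ≤ ‖T n ω - t₀‖}
  set badEq := {ω | (n : ℝ)⁻¹ • ∑ i ∈ Finset.range n, ψ (W i ω) (T n ω) ≠ 0}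
  set badm := {ω | c ≤ (n : ℝ)⁻¹ * ∑ i ∈ Finset.range n, m (W i ω)}
  set badM := {ω | M ≤ ‖(√(n : ℝ))⁻¹ • ∑ i ∈ Finset.range n, ψ (W i ω) t₀‖}
  set badN := {ω | ¬ ∀ i, ∀ t ∈ Metric.ball t₀ δ,
      ‖ψ (W i ω) t - ψ (W i ω) t₀ - fderiv ℝ (ψ (W i ω)) t₀ (t - t₀)‖ ≤ m (W i ω) * ‖t - t₀‖}
  have hN : P.real badN = 0 := (measureReal_eq_zero_iff).2 (ae_iff.1 hremW)
  have hsub : {ω | ε ≤ ‖√(n : ℝ) • (T n ω - t₀)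
      + L ((√(n : ℝ))⁻¹ • ∑ i ∈ Finset.range n, ψ (W i ω) t₀)‖}
      ⊆ badD ∪ badT ∪ badEq ∪ badm ∪ badM ∪ badN := by
    intro ω hω
    by_contra hcon
    simp only [Set.mem_union, Set.mem_ofPred_eq, not_or, not_le, not_not, ne_eq,
      badD, badT, badEq, badm, badM, badN] at hcon hω
    obtain ⟨⟨⟨⟨⟨h1, h2⟩, h3⟩, h4⟩, h5⟩, h6⟩ := hcon
    set x := T n ω - t₀ with hx
    set s := (n : ℝ)⁻¹ • ∑ i ∈ Finset.range n, ψ (W i ω) t₀ with hs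
    have hrem' : ‖s + D n ω x‖ ≤ ((n : ℝ)⁻¹ * ∑ i ∈ Finset.range n, m (W i ω)) * ‖x‖ := by
      -- Since `T n ω` solves the empirical equation here, `s + D x` is minus the averaged Taylor
      -- remainder.
      have heq : s + D n ω x = -((n : ℝ)⁻¹ • ∑ i ∈ Finset.range n,
          (ψ (W i ω) (T n ω) - ψ (W i ω) t₀ - fderiv ℝ (ψ (W i ω)) t₀ x)) := by
        rw [Finset.sum_sub_distrib, Finset.sum_sub_distrib, smul_sub, smul_sub, h3]
        simp only [D, hs, smul_apply, sum_apply]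
        abel
      rw [heq, norm_neg, norm_smul, Real.norm_of_nonneg (inv_nonneg.2 hn0.le), mul_assoc,
        Finset.sum_mul]
      gcongr
      refine (norm_sum_le _ _).trans (Finset.sum_le_sum fun i _ => ?_)
      exact h6 i _ (by simpa [dist_eq_norm] using h2)
    have hlin := norm_add_le_of_approx_linear hL hrem'
      ((mul_le_mul_of_nonneg_left (add_le_add h1.le h4.le) (norm_nonneg _)).trans hcκ)
      (min_le_left _ _)
    have hss : (√(n : ℝ))⁻¹ • ∑ i ∈ Finset.range n, ψ (W i ω) t₀ = √(n : ℝ) • s := by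
      rw [hs, smul_smul]
      congr 1
      rw [← div_eq_mul_inv, Real.sqrt_div_self', one_div]
    rw [hss] at h5 hω
    have hfin : ‖√(n : ℝ) • x + L (√(n : ℝ) • s)‖ ≤ 2 * κ * (‖L‖ * M) := by
      rw [map_smul L (√(n : ℝ)) s, ← smul_add, norm_smul, Real.norm_of_nonneg (Real.sqrt_nonneg _)]
      calc √(n : ℝ) * ‖x + L s‖ ≤ √(n : ℝ) * (2 * κ * ‖L s‖) := by gcongr
        _ = 2 * κ * ‖L (√(n : ℝ) • s)‖ := by
          rw [map_smul L (√(n : ℝ)) s, norm_smul, Real.norm_of_nonneg (Real.sqrt_nonneg _)]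
          ring
        _ ≤ 2 * κ * (‖L‖ * M) := by
          gcongr
          exact (L.le_opNorm _).trans (by gcongr)
    linarith
  calc _ ≤ P.real (badD ∪ badT ∪ badEq ∪ badm ∪ badM ∪ badN) := measureReal_mono hsub
    _ ≤ P.real badD + P.real badT + P.real badEq + P.real badm + P.real badM + P.real badN := by
        refine (measureReal_union_le _ _).trans ?_
        gcongr
        refine (measureReal_union_le _ _).trans ?_
        gcongr
        refine (measureReal_union_le _ _).trans ?_
        gcongr
        refine (measureReal_union_le _ _).trans ?_
        gcongr
        exact measureReal_union_le _ _
    _ < η := by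
        have := hM n
        linarith

end Linearization

/-! ### The stacked estimating function and its matrices -/

section Stacked

variable {𝓨 𝓧 𝓩 : Type*} {p q : ℕ}
  {Ψ : 𝓨 → 𝓧 → 𝓩 → EuclideanSpace ℝ (Fin p) → EuclideanSpace ℝ (Fin q) →
    EuclideanSpace ℝ (Fin p)}
  {g : 𝓧 → 𝓩 → EuclideanSpace ℝ (Fin q) → EuclideanSpace ℝ (Fin q)}

lemma sum_elim_smul_coordDir (x : EuclideanSpace ℝ (Fin p) × EuclideanSpace ℝ (Fin q)) :
    ∑ b, (Sum.elim x.1 x.2 b : ℝ) • coordDir b = x := by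
  rw [Fintype.sum_sum_type]
  ext i
  · simp [coordDir, Prod.fst_sum, Pi.single_apply]
  · simp [coordDir, Prod.snd_sum, Pi.single_apply]

lemma hasFDerivAt_stacked {o : 𝓨 × 𝓧 × 𝓩} {t : EuclideanSpace ℝ (Fin p) × EuclideanSpace ℝ (Fin q)}
    (hΨ : DifferentiableAt ℝ (fun t : EuclideanSpace ℝ (Fin p) × EuclideanSpace ℝ (Fin q) =>
      Ψ o.1 o.2.1 o.2.2 t.1 t.2) t)
    (hg : DifferentiableAt ℝ (fun η => g o.2.1 o.2.2 η) t.2) :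
    HasFDerivAt (stacked Ψ g o) (ContinuousLinearMap.pi (Sum.elim
      (fun i => (EuclideanSpace.proj i).comp (fderiv ℝ (fun t : EuclideanSpace ℝ (Fin p) ×
        EuclideanSpace ℝ (Fin q) => Ψ o.1 o.2.1 o.2.2 t.1 t.2) t))
      (fun j => (EuclideanSpace.proj j).comp ((fderiv ℝ (fun η => g o.2.1 o.2.2 η) t.2).comp
        (ContinuousLinearMap.snd ℝ _ _))))) t := by
  refine hasFDerivAt_pi.2 fun a => ?_
  rcases a with i | j
  · exact (EuclideanSpace.proj i : EuclideanSpace ℝ (Fin p) →L[ℝ] ℝ).hasFDerivAt.comp t hΨ.hasFDerivAt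
  · exact (EuclideanSpace.proj j : EuclideanSpace ℝ (Fin q) →L[ℝ] ℝ).hasFDerivAt.comp t
      (hg.hasFDerivAt.comp t hasFDerivAt_snd)

/-- The target carries the sup norm, and each coordinate is bounded by the Euclidean norm of its
block, so one constant serves both blocks without loss. -/
lemma norm_fderiv_stacked_le {o : 𝓨 × 𝓧 × 𝓩}
    {t : EuclideanSpace ℝ (Fin p) × EuclideanSpace ℝ (Fin q)} {C : ℝ}
    (hΨ : DifferentiableAt ℝ (fun t : EuclideanSpace ℝ (Fin p) × EuclideanSpace ℝ (Fin q) =>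
      Ψ o.1 o.2.1 o.2.2 t.1 t.2) t)
    (hg : DifferentiableAt ℝ (fun η => g o.2.1 o.2.2 η) t.2)
    (hΨC : ‖fderiv ℝ (fun t : EuclideanSpace ℝ (Fin p) × EuclideanSpace ℝ (Fin q) =>
      Ψ o.1 o.2.1 o.2.2 t.1 t.2) t‖ ≤ C)
    (hgC : ‖fderiv ℝ (fun η => g o.2.1 o.2.2 η) t.2‖ ≤ C) :
    ‖fderiv ℝ (stacked Ψ g o) t‖ ≤ C := by
  have hC : 0 ≤ C := (norm_nonneg _).trans hgC
  rw [(hasFDerivAt_stacked hΨ hg).fderiv]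
  refine ContinuousLinearMap.opNorm_le_bound _ hC fun v => ?_
  refine (pi_norm_le_iff_of_nonneg (by positivity)).2 fun a => ?_
  rcases a with i | j
  · exact (PiLp.norm_apply_le _ i).trans (ContinuousLinearMap.le_of_opNorm_le _ hΨC v)
  · exact (PiLp.norm_apply_le _ j).trans ((ContinuousLinearMap.le_of_opNorm_le _ hgC v.2).trans
      (by gcongr; exact norm_snd_le v))

lemma fderiv_stacked_apply {o : 𝓨 × 𝓧 × 𝓩}
    {t : EuclideanSpace ℝ (Fin p) × EuclideanSpace ℝ (Fin q)}
    (h : DifferentiableAt ℝ (stacked Ψ g o) t) (a : Fin p ⊕ Fin q)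
    (v : EuclideanSpace ℝ (Fin p) × EuclideanSpace ℝ (Fin q)) :
    fderiv ℝ (fun t => stacked Ψ g o t a) t v = fderiv ℝ (stacked Ψ g o) t v a := by
  rw [(hasFDerivAt_pi'.1 h.hasFDerivAt a).fderiv]
  rfl

lemma fderiv_stacked_coordDir {o : 𝓨 × 𝓧 × 𝓩} {θ : EuclideanSpace ℝ (Fin p)}
    {η : EuclideanSpace ℝ (Fin q)}
    (hΨ : DifferentiableAt ℝ (fun t : EuclideanSpace ℝ (Fin p) × EuclideanSpace ℝ (Fin q) =>
      Ψ o.1 o.2.1 o.2.2 t.1 t.2) (θ, η))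
    (hg : DifferentiableAt ℝ (fun η => g o.2.1 o.2.2 η) η) (a b : Fin p ⊕ Fin q) :
    fderiv ℝ (fun t => stacked Ψ g o t a) (θ, η) (coordDir b) = Matrix.fromBlocks
      (jacobian (fun θ => Ψ o.1 o.2.1 o.2.2 θ η) θ) (jacobian (fun η => Ψ o.1 o.2.1 o.2.2 θ η) η)
      0 (jacobian (fun η => g o.2.1 o.2.2 η) η) a b := by
  have h := hasFDerivAt_stacked (t := (θ, η)) hΨ hg
  rw [fderiv_stacked_apply h.differentiableAt, h.fderiv]
  rcases a with i | i <;> rcases b with j | j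
  · have := hΨ.hasFDerivAt.comp θ (hasFDerivAt_prodMk_left (𝕜 := ℝ) θ η)
    simp [jacobian, coordDir, HasFDerivAt.fderiv (f := fun θ => Ψ o.1 o.2.1 o.2.2 θ η) this]
  · have := hΨ.hasFDerivAt.comp η (hasFDerivAt_prodMk_right (𝕜 := ℝ) θ η)
    simp [jacobian, coordDir, HasFDerivAt.fderiv (f := fun η => Ψ o.1 o.2.1 o.2.2 θ η) this]
  · simp [coordDir]
  · simp [jacobian, coordDir]

variable [MeasurableSpace 𝓨] [MeasurableSpace 𝓧] [MeasurableSpace 𝓩] {ν : Measure (𝓨 × 𝓧 × 𝓩)}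
  {Θ : EuclideanSpace ℝ (Fin p)} {ξ : EuclideanSpace ℝ (Fin q)}

lemma matA_eq_fromBlocks
    (hΨ : ∀ᵐ o ∂ν, DifferentiableAt ℝ (fun t : EuclideanSpace ℝ (Fin p) ×
      EuclideanSpace ℝ (Fin q) => Ψ o.1 o.2.1 o.2.2 t.1 t.2) (Θ, ξ))
    (hg : ∀ᵐ o ∂ν, DifferentiableAt ℝ (fun η => g o.2.1 o.2.2 η) ξ) :
    matA ν Ψ g Θ ξ = Matrix.fromBlocks
        (expMatrix ν fun o => jacobian (fun θ => Ψ o.1 o.2.1 o.2.2 θ ξ) Θ)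
        (expMatrix ν fun o => jacobian (fun η => Ψ o.1 o.2.1 o.2.2 Θ η) ξ)
        0
        (expMatrix ν fun o => jacobian (fun η => g o.2.1 o.2.2 η) ξ) := by
  have h (a b : Fin p ⊕ Fin q) := integral_congr_ae (hΨ.and hg |>.mono fun o ho =>
    fderiv_stacked_coordDir ho.1 ho.2 a b)
  ext a b
  refine (h a b).trans ?_
  rcases a with i | i <;> rcases b with j | j <;> simp [expMatrix]

/-- Identifies the operator-valued expectation, natural for the expansion, with the entrywise matrix
`A`, so that inverting the matrix inverts the operator. -/
lemma integral_fderiv_stacked_apply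
    (hi : Integrable (fun o => fderiv ℝ (stacked Ψ g o) (Θ, ξ)) ν)
    (hd : ∀ᵐ o ∂ν, DifferentiableAt ℝ (stacked Ψ g o) (Θ, ξ))
    (x : EuclideanSpace ℝ (Fin p) × EuclideanSpace ℝ (Fin q)) :
    (∫ o, fderiv ℝ (stacked Ψ g o) (Θ, ξ) ∂ν) x
      = (matA ν Ψ g Θ ξ).mulVec (Sum.elim x.1 x.2) := by
  have hb (a b : Fin p ⊕ Fin q) : matA ν Ψ g Θ ξ a b
      = (∫ o, fderiv ℝ (stacked Ψ g o) (Θ, ξ) ∂ν) (coordDir b) a := by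
    rw [ContinuousLinearMap.integral_apply hi]
    have h1 := (ContinuousLinearMap.proj (R := ℝ) (φ := fun _ : Fin p ⊕ Fin q => ℝ)
      a).integral_comp_comm (hi.apply_continuousLinearMap (coordDir b))
    refine Eq.trans (integral_congr_ae (hd.mono fun o ho => ?_)) h1
    exact fderiv_stacked_apply ho a _
  ext a
  conv_lhs => rw [← sum_elim_smul_coordDir x, map_sum]
  simp only [map_smul, Finset.sum_apply, Pi.smul_apply, smul_eq_mul, Matrix.mulVec, dotProduct, hb]
  exact Finset.sum_congr rfl fun b _ => mul_comm _ _

lemma matB_isSymm : (matB ν Ψ g Θ ξ).IsSymm := by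
  ext a b
  simp [matB, expMatrix, Matrix.vecMulVec_apply, mul_comm]

lemma dotProduct_matB_mulVec (h2 : MemLp (fun o => stacked Ψ g o (Θ, ξ)) 2 ν)
    (y : Fin p ⊕ Fin q → ℝ) :
    y ⬝ᵥ (matB ν Ψ g Θ ξ).mulVec y = ∫ o, (y ⬝ᵥ stacked Ψ g o (Θ, ξ)) ^ 2 ∂ν := by
  have hint (a b : Fin p ⊕ Fin q) :
      Integrable (fun o => stacked Ψ g o (Θ, ξ) a * stacked Ψ g o (Θ, ξ) b) ν :=
    (h2.eval a).integrable_mul (h2.eval b)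
  have hexp (o : 𝓨 × 𝓧 × 𝓩) : (y ⬝ᵥ stacked Ψ g o (Θ, ξ)) ^ 2 = ∑ a, ∑ b,
      y a * y b * (stacked Ψ g o (Θ, ξ) a * stacked Ψ g o (Θ, ξ) b) := by
    rw [sq, dotProduct, Finset.sum_mul_sum]
    exact Finset.sum_congr rfl fun a _ => Finset.sum_congr rfl fun b _ => by ring
  simp_rw [hexp]
  rw [integral_finsetSum _ fun a _ => integrable_finsetSum _ fun b _ => (hint a b).const_mul _]
  refine Finset.sum_congr rfl fun a _ => ?_
  rw [integral_finsetSum _ fun b _ => (hint a b).const_mul _, Matrix.mulVec, dotProduct,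
    Finset.mul_sum]
  refine Finset.sum_congr rfl fun b _ => ?_
  rw [integral_const_mul]
  simp only [matB, expMatrix, Matrix.of_apply, Matrix.vecMulVec_apply]
  ring

lemma matB_posSemidef (h2 : MemLp (fun o => stacked Ψ g o (Θ, ξ)) 2 ν) :
    (matB ν Ψ g Θ ξ).PosSemidef := by
  refine .of_dotProduct_mulVec_nonneg ?_ fun y => ?_
  · rw [Matrix.IsHermitian, Matrix.conjTranspose_eq_transpose_of_trivial]
    exact matB_isSymm
  · rw [star_trivial, dotProduct_matB_mulVec h2]
    exact integral_nonneg fun o => sq_nonneg _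

lemma asympCov_eq : asympCov ν Ψ g Θ ξ = (matQ p q * (matA ν Ψ g Θ ξ)⁻¹) * matB ν Ψ g Θ ξ
    * (matQ p q * (matA ν Ψ g Θ ξ)⁻¹).transpose := by
  rw [asympCov, Matrix.transpose_mul, Matrix.mul_assoc (_ * _ * _)]

lemma asympCov_posSemidef (h2 : MemLp (fun o => stacked Ψ g o (Θ, ξ)) 2 ν) :
    (asympCov ν Ψ g Θ ξ).PosSemidef := by
  rw [asympCov_eq, ← Matrix.conjTranspose_eq_transpose_of_trivial]
  exact (matB_posSemidef h2).mul_mul_conjTranspose_same _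

/-- Supplies the covariance hypothesis of the central limit theorem: moving `Q A⁻¹` onto `x` reduces
the form to that of `B`. -/
lemma dotProduct_asympCov_mulVec (h2 : MemLp (fun o => stacked Ψ g o (Θ, ξ)) 2 ν)
    (x : Fin p → ℝ) :
    x ⬝ᵥ (asympCov ν Ψ g Θ ξ).mulVec x
      = ∫ o, (x ⬝ᵥ fun i => ((matA ν Ψ g Θ ξ)⁻¹.mulVec (stacked Ψ g o (Θ, ξ))) (Sum.inl i)) ^ 2
        ∂ν := by
  have hQ (v : Fin p ⊕ Fin q → ℝ) : (matQ p q).mulVec v = fun i => v (Sum.inl i) := by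
    ext i
    simp [matQ, Matrix.fromCols_mulVec]
  simp_rw [← hQ, Matrix.mulVec_mulVec, Matrix.dotProduct_mulVec]
  rw [← dotProduct_matB_mulVec h2, asympCov_eq, ← Matrix.dotProduct_mulVec]
  simp_rw [← Matrix.mulVec_mulVec, Matrix.mulVec_transpose, Matrix.dotProduct_mulVec,
    ← Matrix.vecMul_vecMul]

/-- The inverse of the linear map with matrix `A`, with values in the parameter space. -/
noncomputable def solveCLM (A : Matrix (Fin p ⊕ Fin q) (Fin p ⊕ Fin q) ℝ) :
    (Fin p ⊕ Fin q → ℝ) →L[ℝ] EuclideanSpace ℝ (Fin p) × EuclideanSpace ℝ (Fin q) :=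
  LinearMap.toContinuousLinearMap (Fintype.linearCombination ℝ coordDir ∘ₗ Matrix.mulVecLin A⁻¹)

lemma solveCLM_apply (A : Matrix (Fin p ⊕ Fin q) (Fin p ⊕ Fin q) ℝ) (v : Fin p ⊕ Fin q → ℝ) :
    solveCLM A v = ∑ b, A⁻¹.mulVec v b • coordDir b := rfl

lemma solveCLM_apply_fst (A : Matrix (Fin p ⊕ Fin q) (Fin p ⊕ Fin q) ℝ) (v : Fin p ⊕ Fin q → ℝ)
    (i : Fin p) : (solveCLM A v).1 i = A⁻¹.mulVec v (Sum.inl i) := by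
  rw [solveCLM_apply, Fintype.sum_sum_type]
  simp [coordDir, Prod.fst_sum, Pi.single_apply]

lemma solveCLM_mulVec {A : Matrix (Fin p ⊕ Fin q) (Fin p ⊕ Fin q) ℝ} (hA : IsUnit A.det)
    (x : EuclideanSpace ℝ (Fin p) × EuclideanSpace ℝ (Fin q)) :
    solveCLM A (A.mulVec (Sum.elim x.1 x.2)) = x := by
  rw [solveCLM_apply, Matrix.mulVec_mulVec, Matrix.nonsing_inv_mul _ hA, Matrix.one_mulVec,
    sum_elim_smul_coordDir]

end Stacked

/-! ### Convergence in probability of pairs and components -/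

lemma tendstoInMeasure_prodMk {Ω ι E F : Type*} [MeasurableSpace Ω] {P : Measure Ω}
    {l : Filter ι} [PseudoEMetricSpace E] [PseudoEMetricSpace F] {S : ι → Ω → E} {T : ι → Ω → F}
    {s : Ω → E} {t : Ω → F} (hS : TendstoInMeasure P S l s) (hT : TendstoInMeasure P T l t) :
    TendstoInMeasure P (fun n ω => (S n ω, T n ω)) l (fun ω => (s ω, t ω)) := by
  intro ε hε
  refine tendsto_of_tendsto_of_tendsto_of_le_of_le tendsto_const_nhds
    (by simpa using (hS ε hε).add (hT ε hε)) (fun _ => zero_le) (fun n => ?_)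
  refine (measure_mono fun ω hω => ?_).trans (measure_union_le _ _)
  simpa [Prod.edist_eq, le_max_iff] using hω

lemma tendstoInMeasure_fst {Ω ι E F : Type*} [MeasurableSpace Ω] {P : Measure Ω}
    {l : Filter ι} [PseudoEMetricSpace E] [PseudoEMetricSpace F] {S : ι → Ω → E × F}
    {s : Ω → E × F} (hS : TendstoInMeasure P S l s) :
    TendstoInMeasure P (fun n ω => (S n ω).1) l (fun ω => (s ω).1) := fun ε hε =>
  tendsto_of_tendsto_of_tendsto_of_le_of_le tendsto_const_nhds (hS ε hε) (fun _ => zero_le)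
    fun _ => measure_mono fun _ hω => le_trans (Set.mem_ofPred_eq ▸ hω) (le_max_left _ _)

end StackedMEstimation

/-! ### Asymptotic normality with the sandwich covariance -/

theorem lemma2 {Ω 𝓨 𝓧 𝓩 : Type*} [MeasurableSpace Ω]
    [MeasurableSpace 𝓨] [MeasurableSpace 𝓧] [MeasurableSpace 𝓩]
    (P : Measure Ω) [IsProbabilityMeasure P] (p q : ℕ)
    -- independent subjects `(Y_i, X*_i, Z_i)` with common law `ν`
    (Y : ℕ → Ω → 𝓨) (X : ℕ → Ω → 𝓧) (Z : ℕ → Ω → 𝓩) (ν : Measure (𝓨 × 𝓧 × 𝓩))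
    (hlaw : ∀ i, HasLaw (fun ω => (Y i ω, X i ω, Z i ω)) ν P)
    (hindep : iIndepFun (fun i ω => (Y i ω, X i ω, Z i ω)) P)
    -- estimating functions
    (Ψ : 𝓨 → 𝓧 → 𝓩 → EuclideanSpace ℝ (Fin p) → EuclideanSpace ℝ (Fin q) →
      EuclideanSpace ℝ (Fin p))
    (g : 𝓧 → 𝓩 → EuclideanSpace ℝ (Fin q) → EuclideanSpace ℝ (Fin q))
    (hΨm : ∀ θ η, Measurable (fun o : 𝓨 × 𝓧 × 𝓩 => Ψ o.1 o.2.1 o.2.2 θ η))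
    (hgm : ∀ η, Measurable (fun o : 𝓧 × 𝓩 => g o.1 o.2 η))
    -- target parameters: the estimating functions are unbiased and square integrable there
    (Θ : EuclideanSpace ℝ (Fin p)) (ξ : EuclideanSpace ℝ (Fin q))
    (hΨ2 : MemLp (fun o : 𝓨 × 𝓧 × 𝓩 => Ψ o.1 o.2.1 o.2.2 Θ ξ) 2 ν)
    (hg2 : MemLp (fun o : 𝓨 × 𝓧 × 𝓩 => g o.2.1 o.2.2 ξ) 2 ν)
    (hΨ0 : ∫ o, Ψ o.1 o.2.1 o.2.2 Θ ξ ∂ν = 0)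
    (hg0 : ∫ o, g o.2.1 o.2.2 ξ ∂ν = 0)
    -- regularity: continuously differentiable near the target, derivatives dominated there,
    -- nonsingular expected Jacobian
    (r : ℝ) (hr : 0 < r)
    (hΨd : ∀ᵐ o ∂ν, ContDiffOn ℝ 1
      (fun t : EuclideanSpace ℝ (Fin p) × EuclideanSpace ℝ (Fin q) =>
        Ψ o.1 o.2.1 o.2.2 t.1 t.2) (Metric.ball (Θ, ξ) r))
    (hgd : ∀ᵐ o ∂ν, ContDiffOn ℝ 1 (fun η => g o.2.1 o.2.2 η) (Metric.ball ξ r))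
    (H : 𝓨 × 𝓧 × 𝓩 → ℝ) (hH : Integrable H ν)
    (hΨH : ∀ᵐ o ∂ν, ∀ t ∈ Metric.ball (Θ, ξ) r,
      ‖fderiv ℝ (fun t : EuclideanSpace ℝ (Fin p) × EuclideanSpace ℝ (Fin q) =>
        Ψ o.1 o.2.1 o.2.2 t.1 t.2) t‖ ≤ H o)
    (hgH : ∀ᵐ o ∂ν, ∀ η ∈ Metric.ball ξ r, ‖fderiv ℝ (fun η => g o.2.1 o.2.2 η) η‖ ≤ H o)
    (hA : IsUnit (matA ν Ψ g Θ ξ).det)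
    -- the estimators: consistent, and solving the estimating equations with probability
    -- tending to one
    (Θhat : ℕ → Ω → EuclideanSpace ℝ (Fin p)) (ξhat : ℕ → Ω → EuclideanSpace ℝ (Fin q))
    (hΘm : ∀ n, AEMeasurable (Θhat n) P) (hξm : ∀ n, AEMeasurable (ξhat n) P)
    (hξeq : Tendsto (fun n => P {ω | empG g X Z n ω (ξhat n ω) ≠ 0}) atTop (𝓝 0))
    (hΘeq : Tendsto (fun n => P {ω | empU Ψ Y X Z n ω (Θhat n ω) (ξhat n ω) ≠ 0}) atTop (𝓝 0))
    (hξc : TendstoInMeasure P ξhat atTop (fun _ => ξ))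
    (hΘc : TendstoInMeasure P Θhat atTop (fun _ => Θ)) :
    -- `A` is block upper triangular, with the expected partial Jacobians as blocks
    matA ν Ψ g Θ ξ = Matrix.fromBlocks
        (expMatrix ν fun o => jacobian (fun θ => Ψ o.1 o.2.1 o.2.2 θ ξ) Θ)
        (expMatrix ν fun o => jacobian (fun η => Ψ o.1 o.2.1 o.2.2 Θ η) ξ)
        0
        (expMatrix ν fun o => jacobian (fun η => g o.2.1 o.2.2 η) ξ) ∧
    (matB ν Ψ g Θ ξ).IsSymm ∧
    (asympCov ν Ψ g Θ ξ).PosSemidef ∧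
    TendstoInDistribution (fun (n : ℕ) ω => √(n : ℝ) • (Θhat n ω - Θ)) atTop
      (id : EuclideanSpace ℝ (Fin p) → EuclideanSpace ℝ (Fin p)) (fun _ => P)
      (multivariateGaussian 0 (asympCov ν Ψ g Θ ξ)) := by
  set W : ℕ → Ω → 𝓨 × 𝓧 × 𝓩 := fun i ω => (Y i ω, X i ω, Z i ω)
  set ψ := stacked Ψ g with hψdef
  have hν : IsProbabilityMeasure ν := (hlaw 0).isProbabilityMeasure_iff.1 ‹_›
  have hmem : (Θ, ξ) ∈ Metric.ball (Θ, ξ) r := Metric.mem_ball_self hr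
  have hdiff : ∀ᵐ o ∂ν, ∀ t ∈ Metric.ball (Θ, ξ) r,
      DifferentiableAt ℝ (fun t : EuclideanSpace ℝ (Fin p) × EuclideanSpace ℝ (Fin q) =>
        Ψ o.1 o.2.1 o.2.2 t.1 t.2) t ∧ DifferentiableAt ℝ (fun η => g o.2.1 o.2.2 η) t.2 := by
    filter_upwards [hΨd, hgd] with o h1 h2 t ht
    -- In the sup metric a ball of the product is the product of balls, so the hypotheses on `Ψ` and
    -- `g` share the radius `r`.
    rw [← ball_prod_same] at ht
    refine ⟨(h1.differentiableOn one_ne_zero).differentiableAt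
      (Metric.isOpen_ball.mem_nhds (by rwa [← ball_prod_same])),
      (h2.differentiableOn one_ne_zero).differentiableAt (Metric.isOpen_ball.mem_nhds ht.2)⟩
  have hψd : ∀ᵐ o ∂ν, ∀ t ∈ Metric.ball (Θ, ξ) r, DifferentiableAt ℝ (ψ o) t :=
    hdiff.mono fun o ho t ht => (hasFDerivAt_stacked (ho t ht).1 (ho t ht).2).differentiableAt
  have hψH : ∀ᵐ o ∂ν, ∀ t ∈ Metric.ball (Θ, ξ) r, ‖fderiv ℝ (ψ o) t‖ ≤ H o := by
    filter_upwards [hdiff, hΨH, hgH] with o ho h1 h2 t ht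
    refine norm_fderiv_stacked_le (ho t ht).1 (ho t ht).2 (h1 t ht) (h2 _ ?_)
    rw [← ball_prod_same] at ht
    exact ht.2
  have hψm (t : EuclideanSpace ℝ (Fin p) × EuclideanSpace ℝ (Fin q)) :
      Measurable fun o => ψ o t := by
    refine measurable_pi_iff.2 fun a => ?_
    rcases a with i | j
    · exact (EuclideanSpace.proj i : EuclideanSpace ℝ (Fin p) →L[ℝ] ℝ).measurable.comp (hΨm t.1 t.2)
    · exact (EuclideanSpace.proj j : EuclideanSpace ℝ (Fin q) →L[ℝ] ℝ).measurable.comp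
        ((hgm t.2).comp measurable_snd)
  have hψ2 : MemLp (fun o => ψ o (Θ, ξ)) 2 ν := by
    refine memLp_pi_iff.2 fun a => ?_
    rcases a with i | j
    · exact hΨ2.eval_piLp i
    · exact hg2.eval_piLp j
  have hψi : Integrable (fun o => ψ o (Θ, ξ)) ν := hψ2.integrable (by norm_num)
  have hψ0 : ∫ o, ψ o (Θ, ξ) ∂ν = 0 := by
    ext a
    have h1 := (ContinuousLinearMap.proj (R := ℝ) (φ := fun _ : Fin p ⊕ Fin q => ℝ)
      a).integral_comp_comm hψi
    refine h1.symm.trans ?_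
    rcases a with i | j
    · have h2 := (EuclideanSpace.proj i : EuclideanSpace ℝ (Fin p) →L[ℝ] ℝ).integral_comp_comm
        (hΨ2.integrable (by norm_num))
      rw [hΨ0, map_zero] at h2
      exact h2
    · have h2 := (EuclideanSpace.proj j : EuclideanSpace ℝ (Fin q) →L[ℝ] ℝ).integral_comp_comm
        (hg2.integrable (by norm_num))
      rw [hg0, map_zero] at h2
      exact h2
  have hDi : Integrable (fun o => fderiv ℝ (ψ o) (Θ, ξ)) ν :=
    hH.mono' (aestronglyMeasurable_fderiv_param (fun t => (hψm t).aestronglyMeasurable)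
      (hψd.mono fun o ho => ho _ hmem)) (hψH.mono fun o ho => ho _ hmem)
  have hpsd : (asympCov ν Ψ g Θ ξ).PosSemidef := asympCov_posSemidef hψ2
  refine ⟨matA_eq_fromBlocks (hdiff.mono fun o ho => (ho _ hmem).1)
    (hdiff.mono fun o ho => (ho _ hmem).2), matB_isSymm, hpsd, ?_⟩
  set L := solveCLM (matA ν Ψ g Θ ξ) with hLdef
  have hL : L ∘L (∫ o, fderiv ℝ (ψ o) (Θ, ξ) ∂ν) = ContinuousLinearMap.id ℝ _ := by
    refine ContinuousLinearMap.ext fun x => ?_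
    rw [ContinuousLinearMap.comp_apply,
      integral_fderiv_stacked_apply hDi (hψd.mono fun o ho => ho _ hmem)]
    exact solveCLM_mulVec hA x
  have hTeq : Tendsto (fun n : ℕ => P.real {ω | (n : ℝ)⁻¹ • ∑ i ∈ Finset.range n,
      ψ (W i ω) (Θhat n ω, ξhat n ω) ≠ 0}) atTop (𝓝 0) := by
    refine (ENNReal.tendsto_toReal_zero_iff fun n => measure_ne_top _ _).2 ?_
    refine tendsto_of_tendsto_of_tendsto_of_le_of_le tendsto_const_nhds
      (by simpa using hΘeq.add hξeq) (fun _ => zero_le) (fun n => ?_)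
    -- The stacked equation fails only where one of its two blocks fails.
    refine (measure_mono fun ω hω => ?_).trans (measure_union_le _ _)
    by_contra hcon
    simp only [Set.mem_union, Set.mem_ofPred_eq, not_or, not_not] at hcon
    refine hω ?_
    ext a
    rcases a with i | j
    · have := congrArg (fun v : EuclideanSpace ℝ (Fin p) => v i) hcon.1
      simpa [empU, ψ, stacked, W] using this
    · have := congrArg (fun v : EuclideanSpace ℝ (Fin q) => v j) hcon.2
      simpa [empG, ψ, stacked, W] using this
  have hlin := tendstoInMeasure_fst (tendstoInMeasure_linearization hlaw hindep hr hψm hψ2 hψ0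
    (hψd.mono fun o ho t ht => (ho t ht).differentiableWithinAt) hH hψH hL hTeq
    (tendstoInMeasure_prodMk hΘc hξc))
  -- Influence map `-Q A⁻¹`: the sign is irrelevant to the covariance but makes the difference with
  -- `√n (Θhat - Θ)` vanish in probability.
  let K : (Fin p ⊕ Fin q → ℝ) →L[ℝ] EuclideanSpace ℝ (Fin p) :=
    -((ContinuousLinearMap.fst ℝ _ _).comp L)
  have hK (v : Fin p ⊕ Fin q → ℝ) : K v = -(L v).1 := rfl
  have hclt := tendstoInDistribution_scaled_sum hlaw hindep (f := fun o => K (ψ o (Θ, ξ)))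
    (K.measurable.comp (hψm _)) (K.comp_memLp' hψ2)
    (by rw [K.integral_comp_comm hψi, hψ0, map_zero]) hpsd (fun x => by
      rw [dotProduct_asympCov_mulVec hψ2]
      refine integral_congr_ae (ae_of_all _ fun o => ?_)
      simp only [hK, inner_neg_left, neg_sq, PiLp.inner_apply]
      simp [dotProduct, hLdef, solveCLM_apply_fst, hψdef])
  -- Slutsky's theorem: `hlin` bounds the difference from the normalized sum.
  refine tendstoInDistribution_of_tendstoInMeasure_sub _ _ hclt ?_
    fun n => AEMeasurable.const_smul ((hΘm n).sub_const Θ) (√(n : ℝ))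
  refine hlin.congr_left fun n => ae_of_all _ fun ω => ?_
  simp [hK, Prod.fst_sum, Finset.sum_neg_distrib]
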